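/- Let $S_0,S_1,S_2$ be closed (that is, compact and connected) Riemann surfaces and let $\beta_1:S_1\to S_0$, $\beta_2:S_2\to S_0$ be non-constant holomorphic maps. The degree $\deg(\beta_j)$ is the number of preimages of any point of $S_0$ that is not a branch value of $\beta_j$, a branch value being the image of a critical point; such points exist, and this number is finite and the same for all of them. Let $$F=\{(z_1,z_2)\in S_1\times S_2:\ \beta_1(z_1)=\beta_2(z_2)\}$$ be the fiber product of $(S_1,\beta_1)$ and $(S_2,\beta_2)$. Call $(z_1,z_2)\in F$ singular if $z_1$ is a critical point of $\beta_1$ and $z_2$ is a critical point of $\beta_2$. The irreducible components of $F$ are the closures in $F$ of the connected components of the complement in $F$ of the set of singular points; distinct connected components have distinct closures. Then the number of irreducible components of $F$ is finite and at most $\gcd(\deg(\beta_1),\deg(\beta_2))$. -/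

import Mathlib

open scoped Manifold

section FiberProducts

variable {S S₀ S₁ S₂ : Type*}
  [TopologicalSpace S] [ChartedSpace ℂ S]
  [TopologicalSpace S₀] [ChartedSpace ℂ S₀]
  [TopologicalSpace S₁] [ChartedSpace ℂ S₁]
  [TopologicalSpace S₂] [ChartedSpace ℂ S₂]

/-- The critical points of a holomorphic map between Riemann surfaces: the points at which its
complex derivative vanishes. -/
def criticalPoints (β : S → S₀) : Set S :=
  {z | mfderiv 𝓘(ℂ, ℂ) 𝓘(ℂ, ℂ) β z = 0}

/-- The branch values of a holomorphic map: the images of its critical points. -/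
def branchValues (β : S → S₀) : Set S₀ :=
  β '' criticalPoints β

/-- `β` has degree `d`: there are points of `S₀` that are not branch values, and each of them has
exactly `d` preimages. At most one `d` has this property. -/
def HasDegree (β : S → S₀) (d : ℕ) : Prop :=
  (∃ q, q ∉ branchValues β) ∧ ∀ q, q ∉ branchValues β → (β ⁻¹' {q}).encard = d

/-- The (set-theoretic) fiber product of the pairs `(S₁, β₁)` and `(S₂, β₂)`. -/
def fiberProduct (β₁ : S₁ → S₀) (β₂ : S₂ → S₀) : Set (S₁ × S₂) :=
  {z | β₁ z.1 = β₂ z.2}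

/-- The singular points of the fiber product: both coordinates are critical. -/
def singularPoints (β₁ : S₁ → S₀) (β₂ : S₂ → S₀) : Set (S₁ × S₂) :=
  {z | z ∈ fiberProduct β₁ β₂ ∧ z.1 ∈ criticalPoints β₁ ∧ z.2 ∈ criticalPoints β₂}

/-- The complement of the singular points in the fiber product. -/
def regularLocus (β₁ : S₁ → S₀) (β₂ : S₂ → S₀) : Set (S₁ × S₂) :=
  fiberProduct β₁ β₂ \ singularPoints β₁ β₂

/-- The irreducible components of the fiber product, as subsets of it: the closures of the connected
components of the complement of the singular points. (The closed Riemann surface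
attached to such a component is the compactification of the connected component by its punctures;
it is determined by, and determines, that connected component.) The fiber product is closed in
`S₁ × S₂`, so it does not matter in which of the two the closure is taken. -/
def fiberProductIrreducibleComponents (β₁ : S₁ → S₀) (β₂ : S₂ → S₀) :
    Set (Set (S₁ × S₂)) :=
  {R | ∃ x ∈ regularLocus β₁ β₂,
    R = closure (connectedComponentIn (regularLocus β₁ β₂) x)}

/-- Distinct connected components of the regular locus have distinct closures, so that counting
irreducible components is the same as counting these connected components. -/
theorem connectedComponentIn_eq_of_closure_eq (β₁ : S₁ → S₀) (β₂ : S₂ → S₀) {x y : S₁ × S₂}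
    (hx : x ∈ regularLocus β₁ β₂) (hy : y ∈ regularLocus β₁ β₂)
    (h : closure (connectedComponentIn (regularLocus β₁ β₂) x) =
      closure (connectedComponentIn (regularLocus β₁ β₂) y)) :
    connectedComponentIn (regularLocus β₁ β₂) x = connectedComponentIn (regularLocus β₁ β₂) y := by
  have hpre : IsPreconnected
      (closure (connectedComponentIn (regularLocus β₁ β₂) x) ∩ regularLocus β₁ β₂) :=
    isPreconnected_connectedComponentIn.subset_closure
      (fun z hz => ⟨subset_closure hz, connectedComponentIn_subset _ _ hz⟩) Set.inter_subset_left
  refine connectedComponentIn_eq (hpre.subset_connectedComponentIn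
    ⟨subset_closure (mem_connectedComponentIn hx), hx⟩ Set.inter_subset_right ⟨?_, hy⟩)
  rw [h]
  exact subset_closure (mem_connectedComponentIn hy)

end FiberProducts

/-! Choose `q` outside the branch values of both maps, so that `F` has exactly `d₁ * d₂` points over
`q`. Let `C` be a connected component of the regular locus. Away from the finite set of points of
`S₁` lying over branch values of `β₂`, the first projection from `F` is the pullback of a finite
covering, and `C` is open and closed in it. A surface minus a finite set is still connected, so `C`
has equally many points over each of the `d₁` points of `β₁ ⁻¹' {q}`, and `d₁` divides its count
over `q` (`dvd_ncard_inter_fiber_fst`). By symmetry `d₂` does too. The count is nonzero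
(`nonempty_inter_fiber_of_snd`), hence at least `lcm d₁ d₂`. Components are disjoint, so there are
at most `d₁ * d₂ / lcm d₁ d₂ = gcd d₁ d₂` of them. -/

open scoped Topology
open Set Filter

/-! ### Local behaviour of holomorphic maps; finiteness of critical points and fibers -/

section Local

variable {S S₀ : Type*}
  [TopologicalSpace S] [ChartedSpace ℂ S] [TopologicalSpace S₀] [ChartedSpace ℂ S₀]

/-- The expression of `β` in the preferred charts at `z` and `β z`. -/
noncomputable def chartRep (β : S → S₀) (z : S) : ℂ → ℂ :=
  chartAt ℂ (β z) ∘ β ∘ (chartAt ℂ z).symm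

theorem eventually_chartAt_symm {z : S} {p : S → Prop} (h : ∀ᶠ x in 𝓝 z, p x) :
    ∀ᶠ w in 𝓝 (chartAt ℂ z z), w ∈ (chartAt ℂ z).target ∧ p ((chartAt ℂ z).symm w) :=
  ((chartAt ℂ z).open_target.eventually_mem (mem_chart_target ℂ z)).and
    (((chartAt ℂ z).eventually_nhds' p (mem_chart_source ℂ z)).2 h)

theorem eventually_chartAt {z : S} {p : ℂ → Prop} (h : ∀ᶠ w in 𝓝 (chartAt ℂ z z), p w) :
    ∀ᶠ x in 𝓝 z, x ∈ (chartAt ℂ z).source ∧ p (chartAt ℂ z x) :=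
  ((chartAt ℂ z).open_source.eventually_mem (mem_chart_source ℂ z)).and
    (((chartAt ℂ z).continuousAt (mem_chart_source ℂ z)).eventually h)

theorem eventually_mem_source_chartAt {β : S → S₀} (hβ : MDifferentiable 𝓘(ℂ, ℂ) 𝓘(ℂ, ℂ) β)
    (z : S) : ∀ᶠ x in 𝓝 z, β x ∈ (chartAt ℂ (β z)).source :=
  hβ.continuous.continuousAt.eventually
    ((chartAt ℂ (β z)).open_source.mem_nhds (mem_chart_source ℂ (β z)))

theorem deriv_chartRep_ne_zero {β : S → S₀}
    (hβ : MDifferentiable 𝓘(ℂ, ℂ) 𝓘(ℂ, ℂ) β) {z : S} (hz : z ∉ criticalPoints β) :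
    deriv (chartRep β z) (chartAt ℂ z z) ≠ 0 := by
  intro h
  apply hz
  have h1 := (hβ z).mfderiv
  have h2 : mfderiv 𝓘(ℂ, ℂ) 𝓘(ℂ, ℂ) β z = fderiv ℂ (chartRep β z) (chartAt ℂ z z) := by
    rw [h1]
    simp [writtenInExtChartAt, chartRep, extChartAt]
    rfl
  show mfderiv 𝓘(ℂ, ℂ) 𝓘(ℂ, ℂ) β z = 0
  rw [h2]
  have h3 : fderiv ℂ (chartRep β z) (chartAt ℂ z z) = 0 := by
    ext
    simpa using h
  exact h3

variable [IsManifold 𝓘(ℂ, ℂ) 1 S] [IsManifold 𝓘(ℂ, ℂ) 1 S₀]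

theorem hasMFDerivAt_chartRep {β : S → S₀} (hβ : MDifferentiable 𝓘(ℂ, ℂ) 𝓘(ℂ, ℂ) β) (z : S)
    {w : ℂ} (hw : w ∈ (chartAt ℂ z).target)
    (hw' : β ((chartAt ℂ z).symm w) ∈ (chartAt ℂ (β z)).source) :
    HasMFDerivAt 𝓘(ℂ, ℂ) 𝓘(ℂ, ℂ) (chartRep β z) w
      ((mfderiv 𝓘(ℂ, ℂ) 𝓘(ℂ, ℂ) (chartAt ℂ (β z)) (β ((chartAt ℂ z).symm w))).comp
        ((mfderiv 𝓘(ℂ, ℂ) 𝓘(ℂ, ℂ) β ((chartAt ℂ z).symm w)).comp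
          (mfderiv 𝓘(ℂ, ℂ) 𝓘(ℂ, ℂ) (chartAt ℂ z).symm w))) :=
  (mdifferentiableAt_atlas (chart_mem_atlas ℂ (β z)) hw').hasMFDerivAt.comp w
    ((hβ _).hasMFDerivAt.comp w
      (mdifferentiableAt_atlas_symm (chart_mem_atlas ℂ z) hw).hasMFDerivAt)

theorem analyticAt_chartRep {β : S → S₀} (hβ : MDifferentiable 𝓘(ℂ, ℂ) 𝓘(ℂ, ℂ) β) (z : S) :
    AnalyticAt ℂ (chartRep β z) (chartAt ℂ z z) := by
  rw [Complex.analyticAt_iff_eventually_differentiableAt]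
  filter_upwards [eventually_chartAt_symm (eventually_mem_source_chartAt hβ z)] with w hw
  exact (hasMFDerivAt_chartRep hβ z hw.1 hw.2).mdifferentiableAt.differentiableAt

/-- Criticality of `x` refers to the charts at `x` and `β x`; the chain rule transfers it to the
fixed charts at `z` and `β z`, where the identity theorem can be applied. -/
theorem eventually_deriv_chartRep_eq_zero {β : S → S₀}
    (hβ : MDifferentiable 𝓘(ℂ, ℂ) 𝓘(ℂ, ℂ) β) (z : S) :
    ∀ᶠ x in 𝓝 z, x ∈ criticalPoints β → deriv (chartRep β z) (chartAt ℂ z x) = 0 := by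
  filter_upwards [eventually_mem_source_chartAt hβ z,
    (chartAt ℂ z).open_source.mem_nhds (mem_chart_source ℂ z)] with x hx hxs hc
  have hsymm := (chartAt ℂ z).left_inv hxs
  have h := hasMFDerivAt_chartRep hβ z ((chartAt ℂ z).map_source hxs) (by rwa [hsymm])
  have h0 : mfderiv 𝓘(ℂ, ℂ) 𝓘(ℂ, ℂ) β ((chartAt ℂ z).symm (chartAt ℂ z x)) = 0 := by
    rw [hsymm]; exact hc
  rw [h0, ContinuousLinearMap.zero_comp, ContinuousLinearMap.comp_zero] at h
  have h1 : HasFDerivAt (chartRep β z) (0 : ℂ →L[ℂ] ℂ) (chartAt ℂ z x) := h.hasFDerivAt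
  rw [← fderiv_apply_one_eq_deriv, h1.fderiv]
  rfl

/-- A holomorphic map is a local homeomorphism at each noncritical point. -/
theorem isLocalHomeomorphOn_compl_criticalPoints {β : S → S₀}
    (hβ : MDifferentiable 𝓘(ℂ, ℂ) 𝓘(ℂ, ℂ) β) : IsLocalHomeomorphOn β (criticalPoints β)ᶜ := by
  refine IsLocalHomeomorphOn.mk _ _ fun z hz => ?_
  have hs := (analyticAt_chartRep hβ z).hasStrictDerivAt
  have hd := deriv_chartRep_ne_zero hβ hz
  set g := (hs.hasStrictFDerivAt_equiv hd).toOpenPartialHomeomorph _ with hg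
  have hgc : (g : ℂ → ℂ) = chartRep β z := rfl
  have hgs : chartAt ℂ z z ∈ g.source :=
    (hs.hasStrictFDerivAt_equiv hd).mem_toOpenPartialHomeomorph_source
  obtain ⟨U, hU, hUo, hzU⟩ := eventually_nhds_iff.1 (eventually_mem_source_chartAt hβ z)
  refine ⟨(((chartAt ℂ z).trans g).trans (chartAt ℂ (β z)).symm).restrOpen U hUo, ?_, ?_⟩
  · simp [hgs, hgc, chartRep, hzU]
  · intro x hx
    simp [hgc, chartRep] at hx ⊢
    rw [(chartAt ℂ z).left_inv hx.1.1.1, (chartAt ℂ (β z)).left_inv (hU x hx.2)]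

/-- Isolated zeros, applied in charts both to `β - β z` and to the derivative; a derivative
vanishing near `z` again makes `β` constant there. -/
theorem eventually_eq_or_eventually_ne {β : S → S₀}
    (hβ : MDifferentiable 𝓘(ℂ, ℂ) 𝓘(ℂ, ℂ) β) (z : S) :
    (∀ᶠ x in 𝓝 z, β x = β z) ∨
      ∀ᶠ x in 𝓝[≠] z, β x ≠ β z ∧ x ∉ criticalPoints β := by
  have hg := analyticAt_chartRep hβ z
  have hz := (chartAt ℂ z).left_inv (mem_chart_source ℂ z)
  have hconst : (∀ᶠ w in 𝓝 (chartAt ℂ z z), chartRep β z w = chartRep β z (chartAt ℂ z z)) →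
      ∀ᶠ x in 𝓝 z, β x = β z := by
    intro h
    filter_upwards [eventually_chartAt h, eventually_mem_source_chartAt hβ z] with x hx hx'
    have h1 := hx.2
    simp only [chartRep, Function.comp_apply, (chartAt ℂ z).left_inv hx.1, hz] at h1
    exact (chartAt ℂ (β z)).injOn hx' (mem_chart_source ℂ (β z)) h1
  rcases hg.eventually_eq_or_eventually_ne
    (analyticAt_const (v := chartRep β z (chartAt ℂ z z))) with h | h
  · exact .inl (hconst h)
  rcases hg.deriv.eventually_eq_zero_or_eventually_ne_zero with h' | h'
  · refine .inl (hconst ?_)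
    obtain ⟨r, hr, hball⟩ := Metric.eventually_nhds_iff_ball.1
      (h'.and hg.eventually_analyticAt)
    filter_upwards [Metric.ball_mem_nhds _ hr] with w hw
    exact Metric.isOpen_ball.is_const_of_deriv_eq_zero
      (convex_ball _ r).isPreconnected
      (fun y hy => (hball y hy).2.differentiableAt.differentiableWithinAt)
      (fun y hy => (hball y hy).1) hw (Metric.mem_ball_self hr)
  · right
    rw [eventually_nhdsWithin_iff] at h h' ⊢
    filter_upwards [eventually_chartAt (h.and h'), eventually_deriv_chartRep_eq_zero hβ z]
      with x hx hx' hne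
    have hne' : chartAt ℂ z x ≠ chartAt ℂ z z :=
      fun h => hne ((chartAt ℂ z).injOn hx.1 (mem_chart_source ℂ z) h)
    refine ⟨fun h => hx.2.1 hne' ?_, fun h => hx.2.2 hne' (hx' h)⟩
    simp [chartRep, (chartAt ℂ z).left_inv hx.1, hz, h]

/-- The set `A` where `β` is locally constant is open and consists of critical points. By the local
dichotomy, a point outside `A` has a neighborhood missing `A`, so `A` is also closed; connectedness
then excludes the constant alternative. -/
theorem eventually_notMem_criticalPoints {β : S → S₀} [PreconnectedSpace S]
    (hβ : MDifferentiable 𝓘(ℂ, ℂ) 𝓘(ℂ, ℂ) β) (hc : ¬ ∃ c, ∀ z, β z = c) (z : S) :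
    ∀ᶠ x in 𝓝[≠] z, β x ≠ β z ∧ x ∉ criticalPoints β := by
  let A : Set S := {z | ∀ᶠ x in 𝓝 z, β x = β z}
  have hAo : IsOpen A := by
    rw [isOpen_iff_mem_nhds]
    intro z hz
    filter_upwards [hz.eventually_nhds, hz] with x hx hxz
    simpa [A, hxz] using hx
  have hAcrit : A ⊆ criticalPoints β := by
    intro x hx
    have h : β =ᶠ[𝓝 x] fun _ => β x := hx
    show mfderiv 𝓘(ℂ, ℂ) 𝓘(ℂ, ℂ) β x = 0
    rw [h.mfderiv_eq, mfderiv_const]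
  have hAc : IsClosed A := by
    rw [← isOpen_compl_iff, isOpen_iff_mem_nhds]
    intro z hz
    have h := (eventually_eq_or_eventually_ne hβ z).resolve_left hz
    rw [eventually_nhdsWithin_iff] at h
    filter_upwards [h] with x hx hxA
    by_cases hxz : x = z
    · exact hz (hxz ▸ hxA)
    · exact (hx hxz).2 (hAcrit hxA)
  refine (eventually_eq_or_eventually_ne hβ z).resolve_left fun hz => hc ⟨β z, fun y => ?_⟩
  have hA : A = univ := IsClopen.eq_univ ⟨hAc, hAo⟩ ⟨z, hz⟩
  have hl : IsLocallyConstant β := by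
    rw [IsLocallyConstant.iff_eventually_eq]
    intro x
    have : x ∈ A := hA ▸ mem_univ x
    exact this
  exact hl.apply_eq_of_preconnectedSpace y z

theorem Set.Finite.of_eventually_nhdsNE {X : Type*} [TopologicalSpace X] [CompactSpace X]
    {K : Set X} (h : ∀ z, ∀ᶠ x in 𝓝[≠] z, x ∉ K) : K.Finite := by
  by_contra hK
  obtain ⟨z, hz⟩ := Set.Infinite.exists_accPt_principal hK
  rw [accPt_iff_frequently_nhdsNE] at hz
  exact hz (h z)

theorem finite_criticalPoints {β : S → S₀} [CompactSpace S] [PreconnectedSpace S]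
    (hβ : MDifferentiable 𝓘(ℂ, ℂ) 𝓘(ℂ, ℂ) β) (hc : ¬ ∃ c, ∀ z, β z = c) :
    (criticalPoints β).Finite :=
  .of_eventually_nhdsNE fun z => (eventually_notMem_criticalPoints hβ hc z).mono fun _ h => h.2

theorem finite_preimage_of_finite {β : S → S₀} [CompactSpace S] [PreconnectedSpace S] [T1Space S₀]
    (hβ : MDifferentiable 𝓘(ℂ, ℂ) 𝓘(ℂ, ℂ) β) (hc : ¬ ∃ c, ∀ z, β z = c) {T : Set S₀}
    (hT : T.Finite) : (β ⁻¹' T).Finite := by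
  refine hT.preimage' fun c _ => .of_eventually_nhdsNE fun z => ?_
  by_cases hz : β z = c
  · exact (eventually_notMem_criticalPoints hβ hc z).mono fun _ h => hz ▸ h.1
  · exact (hβ.continuous.continuousAt.eventually_ne hz).filter_mono nhdsWithin_le_nhds

end Local

/-! ### Finite sets do not disconnect a surface -/

section PuncturedDisc

/-- The exponential maps a left half-plane, which is convex, onto a punctured disc. -/
theorem isPreconnected_ball_diff_center (p : ℂ) (r : ℝ) :
    IsPreconnected (Metric.ball p r \ {p}) := by
  rcases le_or_gt r 0 with hr | hr
  · simp [Metric.ball_eq_empty.2 hr, isPreconnected_empty]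
  have h : Metric.ball p r \ {p} = (fun w => p + Complex.exp w) '' {w | w.re < Real.log r} := by
    ext z
    simp only [Set.mem_sdiff, Metric.mem_ball, mem_singleton_iff, mem_image, mem_ofPred_eq]
    constructor
    · rintro ⟨h1, h2⟩
      have h0 : z - p ≠ 0 := sub_ne_zero.2 h2
      refine ⟨Complex.log (z - p), ?_, by rw [Complex.exp_log h0]; ring⟩
      rw [Complex.log_re]
      exact Real.log_lt_log (norm_pos_iff.2 h0) (by rwa [← dist_eq_norm])
    · rintro ⟨w, hw, rfl⟩
      refine ⟨?_, by simp [Complex.exp_ne_zero]⟩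
      rw [dist_eq_norm, add_sub_cancel_left, Complex.norm_exp]
      exact (Real.lt_log_iff_exp_lt hr).1 hw
  rw [h]
  exact (convex_halfSpace_re_lt _).isPreconnected.image _ (by fun_prop)

variable {S α : Type*} [TopologicalSpace S] [ChartedSpace ℂ S]

theorem neBot_nhdsNE_of_chartedSpace (z : S) : (𝓝[≠] z).NeBot := by
  rw [neBot_iff, ne_eq, ← isOpen_singleton_iff_punctured_nhds]
  intro h
  have h1 := (chartAt ℂ z).isOpen_image_of_subset_source h
    (singleton_subset_iff.2 (mem_chart_source ℂ z))
  rw [image_singleton] at h1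
  exact not_isOpen_singleton _ h1

theorem Set.Finite.eventually_nhdsNE_notMem {X : Type*} [TopologicalSpace X] [T1Space X] {T : Set X}
    (hT : T.Finite) (z : X) : ∀ᶠ x in 𝓝[≠] z, x ∉ T := by
  have h1 : ∀ᶠ x in 𝓝 z, x ∉ T \ {z} :=
    (hT.subset sdiff_subset).isClosed.isOpen_compl.mem_nhds (by simp)
  rw [eventually_nhdsWithin_iff]
  filter_upwards [h1] with x hx hxz hxT using hx ⟨hxT, hxz⟩

theorem exists_eventually_nhdsNE_eq {z : S} {n : S → α}
    (h : ∀ᶠ x in 𝓝[≠] z, ∀ᶠ y in 𝓝 x, n y = n x) : ∃ k, ∀ᶠ x in 𝓝[≠] z, n x = k := by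
  rw [eventually_nhdsWithin_iff] at h
  obtain ⟨r, hr, hball⟩ := Metric.eventually_nhds_iff_ball.1 (eventually_chartAt_symm h)
  set φ := chartAt ℂ z
  have hconn := isPreconnected_ball_diff_center (φ z) r
  let D := Metric.ball (φ z) r \ {φ z}
  have hz : φ.symm (φ z) = z := φ.left_inv (mem_chart_source ℂ z)
  have hl : IsLocallyConstant fun w : D => n (φ.symm w) := by
    rw [IsLocallyConstant.iff_eventually_eq]
    rintro ⟨w, hw⟩
    have hb := hball w hw.1
    have hne : φ.symm w ≠ z := fun h => hw.2 (by rw [← h, φ.right_inv hb.1]; rfl)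
    have hcont : ContinuousAt (fun w : D => φ.symm w) ⟨w, hw⟩ :=
      ContinuousAt.comp (g := φ.symm) (φ.continuousAt_symm hb.1) continuousAt_subtype_val
    exact hcont.eventually (hb.2 hne)
  have : PreconnectedSpace D := isPreconnected_iff_preconnectedSpace.1 hconn
  have hcst : ∃ k, ∀ w ∈ D, n (φ.symm w) = k := by
    rcases D.eq_empty_or_nonempty with hD | ⟨w₀, hw₀⟩
    · exact ⟨n z, by simp [hD]⟩
    · exact ⟨_, fun w hw => hl.apply_eq_of_preconnectedSpace ⟨w, hw⟩ ⟨w₀, hw₀⟩⟩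
  obtain ⟨k, hk⟩ := hcst
  refine ⟨k, ?_⟩
  rw [eventually_nhdsWithin_iff]
  filter_upwards [eventually_chartAt (Metric.ball_mem_nhds (φ z) hr)] with x hx hxz
  rw [← hk (φ x) ⟨hx.2, fun h => hxz (φ.injOn hx.1 (mem_chart_source ℂ z) h)⟩, φ.left_inv hx.1]

/-- A function on a connected surface that is locally constant off a finite set is constant
off that set. -/
theorem eq_of_eventually_eq_off_finite [T1Space S] [PreconnectedSpace S] {T : Set S}
    (hT : T.Finite) {n : S → α} (h : ∀ x ∉ T, ∀ᶠ y in 𝓝 x, n y = n x) {x y : S}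
    (hx : x ∉ T) (hy : y ∉ T) : n x = n y := by
  have := neBot_nhdsNE_of_chartedSpace (S := S)
  have hev (z : S) : ∃ k, ∀ᶠ x in 𝓝[≠] z, n x = k := by
    exact exists_eventually_nhdsNE_eq ((hT.eventually_nhdsNE_notMem z).mono h)
  -- `N z` is the value of `n` on a punctured neighborhood of `z`: it agrees with `n` off `T` and is
  -- locally constant on all of `S`.
  choose N hN using hev
  have hNn (x : S) (hx : x ∉ T) : N x = n x := by
    obtain ⟨y, hy1, hy2⟩ := ((hN x).and ((h x hx).filter_mono nhdsWithin_le_nhds)).exists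
    rw [← hy1, hy2]
  have hl : IsLocallyConstant N := by
    rw [IsLocallyConstant.iff_eventually_eq]
    intro z
    have h1 := hN z
    rw [eventually_nhdsWithin_iff] at h1
    filter_upwards [h1.eventually_nhds] with x hx
    by_cases hxz : x = z
    · rw [hxz]
    · have h2 : ∀ᶠ y in 𝓝[≠] x, n y = N z := by
        filter_upwards [hx.filter_mono nhdsWithin_le_nhds,
          (eventually_ne_nhds hxz).filter_mono nhdsWithin_le_nhds] with y hy hyz using hy hyz
      obtain ⟨y, hy1, hy2⟩ := ((hN x).and h2).exists
      rw [← hy1, hy2]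
  rw [← hNn x hx, ← hNn y hy]
  exact hl.apply_eq_of_preconnectedSpace x y

end PuncturedDisc

/-! ### Counting points in fibers of a pulled-back covering -/

section FiberCount

/-- The number of points of `C` in the fibers over `a'`, of the pullback along `P` of a finite
covering `f`, is locally constant when `C` is open and closed in the pullback near the fiber. -/
theorem eventually_encard_fiber_eq {X E Y : Type*} [TopologicalSpace X] [TopologicalSpace E]
    [TopologicalSpace Y] {f : E → Y} {P : X → Y} {a : X} (hP : ContinuousAt P a)
    (hf : IsEvenlyCovered f (P a) (f ⁻¹' {P a})) (hfin : (f ⁻¹' {P a}).Finite) {C : Set (X × E)}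
    (hC : ∀ b, f b = P a → ∀ᶠ w in 𝓝 (a, b), f w.2 = P w.1 → (w ∈ C ↔ (a, b) ∈ C)) :
    ∀ᶠ a' in 𝓝 a, {b | f b = P a' ∧ (a', b) ∈ C}.encard = {b | f b = P a ∧ (a, b) ∈ C}.encard := by
  have : Finite (f ⁻¹' {P a}) := hfin
  rcases isEmpty_or_nonempty (f ⁻¹' {P a}) with hI | hI
  -- An empty fiber stays empty nearby, because the preimage of `U` is a product with the empty
  -- fiber.
  · obtain ⟨-, U, hU, hUo, -, H, -⟩ := hf
    have hUe (b : E) : f b ∉ U := fun hb => hI.elim (H ⟨b, hb⟩).2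
    filter_upwards [hP.eventually (hUo.mem_nhds hU)] with a' ha'
    congr 1
    ext b
    constructor
    · rintro ⟨h, -⟩
      exact (hUe b (h ▸ ha')).elim
    · rintro ⟨h, -⟩
      exact (hUe b (h ▸ hU)).elim
  let t := hf.toTrivialization
  have hta : P a ∈ t.baseSet := hf.mem_toTrivialization_baseSet
  -- `s i` is the `i`-th sheet over the base set; the count becomes the number of sheets meeting
  -- `C`, and each of these finitely many memberships is locally constant.
  let s (i : f ⁻¹' {P a}) (x : Y) : E := t.toOpenPartialHomeomorph.symm (x, i)
  have hs {x : Y} (hx : x ∈ t.baseSet) (i) : f (s i x) = x := t.proj_symm_apply' hx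
  have hinj {x : Y} (hx : x ∈ t.baseSet) : Function.Injective fun i => s i x := by
    intro i j hij
    have h : t (s i x) = t (s j x) := congrArg t hij
    rw [t.apply_symm_apply' hx, t.apply_symm_apply' hx] at h
    exact congrArg Prod.snd h
  have himage {x : Y} (hx : x ∈ t.baseSet) (D : Set E) :
      {b | f b = x ∧ b ∈ D} = (fun i => s i x) '' {i | s i x ∈ D} := by
    ext b
    constructor
    · rintro ⟨rfl, hb⟩
      have h : s (t b).2 (f b) = b := t.symm_apply_mk_proj (t.mem_source.2 hx)
      exact ⟨(t b).2, by rwa [mem_ofPred_eq, h], h⟩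
    · rintro ⟨i, hi, rfl⟩
      exact ⟨hs hx i, hi⟩
  have hcount {a' : X} (h : P a' ∈ t.baseSet) :
      {b | f b = P a' ∧ (a', b) ∈ C}.encard = {i | (a', s i (P a')) ∈ C}.encard := by
    rw [show {b | f b = P a' ∧ (a', b) ∈ C} = _ from himage h {b | (a', b) ∈ C},
      (hinj h).encard_image]
    rfl
  have hbase : ∀ᶠ a' in 𝓝 a, P a' ∈ t.baseSet := hP.eventually (t.open_baseSet.mem_nhds hta)
  have hmem : ∀ᶠ a' in 𝓝 a, ∀ i, (a', s i (P a')) ∈ C ↔ (a, s i (P a)) ∈ C := by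
    rw [eventually_all]
    intro i
    have hcs : ContinuousAt (fun a' => s i (P a')) a := by
      have h1 : ContinuousAt t.toOpenPartialHomeomorph.symm (P a, i) :=
        t.toOpenPartialHomeomorph.continuousAt_symm (t.mem_target.2 hta)
      exact ContinuousAt.comp (f := fun a' => (P a', i)) h1 (hP.prodMk continuousAt_const)
    have h2 : ContinuousAt (fun a' => (a', s i (P a'))) a := continuousAt_id.prodMk hcs
    filter_upwards [h2.eventually (hC _ (hs hta i)), hbase] with a' h h'
    exact h (hs h' i)
  filter_upwards [hbase, hmem] with a' h1 h2
  rw [hcount h1, hcount hta]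
  simp only [h2]

end FiberCount

/-! ### Existence of the degree -/

section Degree

variable {S S₀ : Type*}
  [TopologicalSpace S] [T2Space S] [CompactSpace S] [ConnectedSpace S]
  [ChartedSpace ℂ S] [IsManifold 𝓘(ℂ, ℂ) 1 S]
  [TopologicalSpace S₀] [T2Space S₀] [ConnectedSpace S₀]
  [ChartedSpace ℂ S₀] [IsManifold 𝓘(ℂ, ℂ) 1 S₀]

omit [ConnectedSpace S] [ConnectedSpace S₀] in
-- No critical point lies over the complement of the branch values, so `β` is a local homeomorphism
-- there; compactness of `S` makes it a covering.
theorem isCoveringMapOn_compl_branchValues {β : S → S₀}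
    (hβ : MDifferentiable 𝓘(ℂ, ℂ) 𝓘(ℂ, ℂ) β) : IsCoveringMapOn β (branchValues β)ᶜ :=
  .of_isLocalHomeomorphOn hβ.continuous
    ((isLocalHomeomorphOn_compl_criticalPoints hβ).mono fun _ hz hc => hz ⟨_, hc, rfl⟩)

theorem Set.Finite.exists_notMem_of_chartedSpace {X : Type*} [TopologicalSpace X] [T1Space X]
    [ChartedSpace ℂ X] [Nonempty X] {T : Set X} (hT : T.Finite) : ∃ x, x ∉ T :=
  have := neBot_nhdsNE_of_chartedSpace (Classical.arbitrary X)
  (hT.eventually_nhdsNE_notMem (Classical.arbitrary X)).exists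

theorem exists_hasDegree {β : S → S₀} (hβ : MDifferentiable 𝓘(ℂ, ℂ) 𝓘(ℂ, ℂ) β)
    (hc : ¬ ∃ c, ∀ z, β z = c) : ∃ d, 0 < d ∧ HasDegree β d := by
  have hB : (branchValues β).Finite := (finite_criticalPoints hβ hc).image β
  have hfin (q : S₀) : (β ⁻¹' {q}).Finite := finite_preimage_of_finite hβ hc (finite_singleton q)
  -- Choosing the reference value in the image of `β` makes the degree positive without a separate
  -- proof of surjectivity.
  obtain ⟨z, hz⟩ := (finite_preimage_of_finite hβ hc hB).exists_notMem_of_chartedSpace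
  refine ⟨(β ⁻¹' {β z}).ncard, (ncard_pos (hfin _)).2 ⟨z, rfl⟩, ⟨β z, hz⟩, fun q hq => ?_⟩
  rw [(hfin _).cast_ncard_eq]
  refine eq_of_eventually_eq_off_finite (n := fun q => (β ⁻¹' {q}).encard) hB (fun x hx => ?_) hq hz
  have h := eventually_encard_fiber_eq (P := id) (a := x) (C := univ) continuousAt_id
    (isCoveringMapOn_compl_branchValues hβ x hx) (hfin x) (by simp)
  simp only [mem_univ, and_true] at h
  exact h

end Degree

/-! ### Local structure of the regular locus -/

section Components

variable {S₀ S₁ S₂ : Type*}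
  [TopologicalSpace S₀] [ChartedSpace ℂ S₀]
  [TopologicalSpace S₁] [ChartedSpace ℂ S₁]
  [TopologicalSpace S₂] [ChartedSpace ℂ S₂]

theorem swap_mem_regularLocus {β₁ : S₁ → S₀} {β₂ : S₂ → S₀} {w : S₁ × S₂} :
    w.swap ∈ regularLocus β₂ β₁ ↔ w ∈ regularLocus β₁ β₂ := by
  simp only [regularLocus, singularPoints, fiberProduct, Set.mem_sdiff, mem_ofPred_eq, Prod.fst_swap,
    Prod.snd_swap]
  constructor <;> rintro ⟨h, h'⟩ <;> exact ⟨h.symm, fun hs => h' ⟨h, hs.2.2, hs.2.1⟩⟩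

theorem mem_regularLocus_of_snd {β₁ : S₁ → S₀} {β₂ : S₂ → S₀} {w : S₁ × S₂}
    (h : β₁ w.1 = β₂ w.2) (h' : w.2 ∉ criticalPoints β₂) : w ∈ regularLocus β₁ β₂ :=
  ⟨h, fun hs => h' hs.2.2⟩

theorem tendsto_swap_regularLocus {β₁ : S₁ → S₀} {β₂ : S₂ → S₀} (w : S₁ × S₂) :
    Tendsto Prod.swap (𝓝[regularLocus β₁ β₂] w) (𝓝[regularLocus β₂ β₁] w.swap) :=
  tendsto_nhdsWithin_iff.2 ⟨continuous_swap.continuousAt.mono_left nhdsWithin_le_nhds,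
    eventually_mem_nhdsWithin.mono fun _ h => swap_mem_regularLocus.2 h⟩

/-- Near a point whose second coordinate is noncritical, the regular locus is the graph of a
continuous function on an open set. -/
theorem exists_graph_regularLocus {β₁ : S₁ → S₀} {β₂ : S₂ → S₀} (h₁ : Continuous β₁)
    (h₂ : IsLocalHomeomorphOn β₂ (criticalPoints β₂)ᶜ) (hcl : IsClosed (criticalPoints β₂))
    {w : S₁ × S₂} (hw : w ∈ regularLocus β₁ β₂) (hw2 : w.2 ∉ criticalPoints β₂) :
    ∃ (g : S₁ → S₂) (N : Set S₁), IsOpen N ∧ w.1 ∈ N ∧ ContinuousOn g N ∧ g w.1 = w.2 ∧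
      (∀ a ∈ N, (a, g a) ∈ regularLocus β₁ β₂) ∧
      ∀ᶠ w' in 𝓝[regularLocus β₁ β₂] w, w'.1 ∈ N ∧ w'.2 = g w'.1 := by
  obtain ⟨e, hes, hee⟩ := h₂ w.2 hw2
  have hβw : β₁ w.1 = e w.2 := hee ▸ hw.1
  let V : Set S₀ := e.target ∩ e.symm ⁻¹' (criticalPoints β₂)ᶜ
  have hV : IsOpen V := e.symm.isOpen_inter_preimage hcl.isOpen_compl
  have hgw : e.symm (β₁ w.1) = w.2 := by rw [hβw, e.left_inv hes]
  have hwN : w.1 ∈ β₁ ⁻¹' V := by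
    refine ⟨hβw ▸ e.map_source hes, ?_⟩
    rw [mem_preimage, hgw]
    exact hw2
  refine ⟨fun a => e.symm (β₁ a), β₁ ⁻¹' V, hV.preimage h₁, hwN, ?_, hgw, ?_, ?_⟩
  · exact e.continuousOn_symm.comp h₁.continuousOn fun a ha => ha.1
  · intro a ha
    refine mem_regularLocus_of_snd ?_ ha.2
    rw [hee, e.right_inv ha.1]
  · have ha : ∀ᶠ w' in 𝓝 w, w'.1 ∈ β₁ ⁻¹' V :=
      continuousAt_fst.eventually ((hV.preimage h₁).mem_nhds hwN)
    have hb : ∀ᶠ w' in 𝓝 w, w'.2 ∈ e.source :=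
      continuousAt_snd.eventually (e.open_source.mem_nhds hes)
    filter_upwards [ha.filter_mono nhdsWithin_le_nhds, hb.filter_mono nhdsWithin_le_nhds,
      eventually_mem_nhdsWithin] with w' ha hb hr
    refine ⟨ha, ?_⟩
    have h : β₁ w'.1 = e w'.2 := hee ▸ hr.1
    rw [h, e.left_inv hb]

/-- `C` is open and closed relative to `R`. -/
def IsClopenIn {X : Type*} [TopologicalSpace X] (C R : Set X) : Prop :=
  ∀ w ∈ R, ∀ᶠ w' in 𝓝[R] w, (w' ∈ C ↔ w ∈ C)

theorem IsClopenIn.swap_regularLocus {β₁ : S₁ → S₀} {β₂ : S₂ → S₀} {C : Set (S₁ × S₂)}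
    (hC : IsClopenIn C (regularLocus β₁ β₂)) :
    IsClopenIn (Prod.swap ⁻¹' C) (regularLocus β₂ β₁) := fun w hw =>
  (tendsto_swap_regularLocus w).eventually (hC w.swap (swap_mem_regularLocus.2 hw))

/-- A connected neighborhood of a point within `R` lies in a single component. -/
theorem isClopenIn_connectedComponentIn {X : Type*} [TopologicalSpace X] {R : Set X}
    (h : ∀ w ∈ R, ∃ V ∈ 𝓝[R] w, w ∈ V ∧ V ⊆ R ∧ IsPreconnected V) (x : X) :
    IsClopenIn (connectedComponentIn R x) R := by
  intro w hw
  obtain ⟨V, hV, hwV, hVR, hVc⟩ := h w hw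
  filter_upwards [hV] with w' hw'
  have h1 : w' ∈ connectedComponentIn R w := hVc.subset_connectedComponentIn hwV hVR hw'
  have h2 : w ∈ connectedComponentIn R w' := hVc.subset_connectedComponentIn hw' hVR hwV
  constructor
  · intro h3
    rwa [connectedComponentIn_eq h3]
  · intro h3
    rwa [connectedComponentIn_eq h3]

theorem exists_preconnected_nhdsWithin_of_snd {β₁ : S₁ → S₀} {β₂ : S₂ → S₀} (h₁ : Continuous β₁)
    (h₂ : IsLocalHomeomorphOn β₂ (criticalPoints β₂)ᶜ) (hcl : IsClosed (criticalPoints β₂))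
    {w : S₁ × S₂} (hw : w ∈ regularLocus β₁ β₂) (hw2 : w.2 ∉ criticalPoints β₂) :
    ∃ V ∈ 𝓝[regularLocus β₁ β₂] w, w ∈ V ∧ V ⊆ regularLocus β₁ β₂ ∧ IsPreconnected V := by
  obtain ⟨g, N, hN, hwN, hg, hgw, hreg, hev⟩ := exists_graph_regularLocus h₁ h₂ hcl hw hw2
  have := ChartedSpace.locallyConnectedSpace ℂ S₁
  obtain ⟨M, hMN, hMo, hwM, hMc⟩ :=
    locallyConnectedSpace_iff_subsets_isOpen_isConnected.1 this w.1 N (hN.mem_nhds hwN)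
  refine ⟨(fun a => (a, g a)) '' M, ?_, ⟨w.1, hwM, by simp [hgw]⟩, ?_, ?_⟩
  · have ha : ∀ᶠ w' in 𝓝 w, w'.1 ∈ M := continuousAt_fst.eventually (hMo.mem_nhds hwM)
    filter_upwards [hev, ha.filter_mono nhdsWithin_le_nhds] with w' h h'
    exact ⟨w'.1, h', Prod.ext rfl h.2.symm⟩
  · rintro _ ⟨a, ha, rfl⟩
    exact hreg a (hMN ha)
  · exact hMc.isPreconnected.image _ (continuousOn_id.prodMk (hg.mono hMN))

/-- At a regular point some coordinate is noncritical, so up to swapping the factors the locus is a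
graph there. -/
theorem exists_preconnected_nhdsWithin {β₁ : S₁ → S₀} {β₂ : S₂ → S₀}
    (hc₁ : Continuous β₁) (hc₂ : Continuous β₂)
    (h₁ : IsLocalHomeomorphOn β₁ (criticalPoints β₁)ᶜ) (hcl₁ : IsClosed (criticalPoints β₁))
    (h₂ : IsLocalHomeomorphOn β₂ (criticalPoints β₂)ᶜ) (hcl₂ : IsClosed (criticalPoints β₂))
    (w : S₁ × S₂) (hw : w ∈ regularLocus β₁ β₂) :
    ∃ V ∈ 𝓝[regularLocus β₁ β₂] w, w ∈ V ∧ V ⊆ regularLocus β₁ β₂ ∧ IsPreconnected V := by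
  by_cases hw2 : w.2 ∈ criticalPoints β₂
  · have hw1 : w.1 ∉ criticalPoints β₁ := fun h => hw.2 ⟨hw.1, h, hw2⟩
    obtain ⟨V, hV, hwV, hVR, hVc⟩ := exists_preconnected_nhdsWithin_of_snd hc₂ h₁ hcl₁
      (swap_mem_regularLocus.2 hw) hw1
    refine ⟨Prod.swap ⁻¹' V, tendsto_swap_regularLocus w hV, hwV,
      fun v hv => swap_mem_regularLocus.1 (hVR hv), ?_⟩
    rw [← image_swap_eq_preimage_swap]
    exact hVc.image _ continuous_swap.continuousOn
  · exact exists_preconnected_nhdsWithin_of_snd hc₁ h₂ hcl₂ hw hw2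

end Components

/-! ### Points of an open and closed part over a common regular value -/

theorem ncard_inter_fiber_swap {S₀ S₁ S₂ : Type*} {β₁ : S₁ → S₀} {β₂ : S₂ → S₀} (C : Set (S₁ × S₂))
    (q : S₀) :
    (Prod.swap ⁻¹' C ∩ (β₂ ⁻¹' {q}) ×ˢ (β₁ ⁻¹' {q})).ncard =
      (C ∩ (β₁ ⁻¹' {q}) ×ˢ (β₂ ⁻¹' {q})).ncard := by
  rw [← ncard_image_of_injective _ Prod.swap_injective, image_swap_eq_preimage_swap]
  congr 1
  ext ⟨x, y⟩
  simp [and_comm]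

section Count

variable {S₀ S₁ S₂ : Type*}
  [TopologicalSpace S₀] [T2Space S₀] [ChartedSpace ℂ S₀] [IsManifold 𝓘(ℂ, ℂ) 1 S₀]
  [TopologicalSpace S₁] [T2Space S₁] [CompactSpace S₁] [ConnectedSpace S₁]
  [ChartedSpace ℂ S₁] [IsManifold 𝓘(ℂ, ℂ) 1 S₁]
  [TopologicalSpace S₂] [T2Space S₂] [CompactSpace S₂] [ConnectedSpace S₂]
  [ChartedSpace ℂ S₂] [IsManifold 𝓘(ℂ, ℂ) 1 S₂]
  {β₁ : S₁ → S₀} {β₂ : S₂ → S₀}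

/-- The count over a point of `S₁` is locally constant off the finite set `β₁ ⁻¹' branchValues β₂`:
the points of `F` over such a point have noncritical second coordinate, so near them `F` is regular
and `C` is open and closed in it. -/
theorem encard_snd_fiber_eq
    (hβ₁ : MDifferentiable 𝓘(ℂ, ℂ) 𝓘(ℂ, ℂ) β₁) (hβ₂ : MDifferentiable 𝓘(ℂ, ℂ) 𝓘(ℂ, ℂ) β₂)
    (hc₁ : ¬ ∃ c, ∀ z, β₁ z = c) (hc₂ : ¬ ∃ c, ∀ z, β₂ z = c)
    {C : Set (S₁ × S₂)} (hC : IsClopenIn C (regularLocus β₁ β₂)) {a a' : S₁}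
    (ha : β₁ a ∉ branchValues β₂) (ha' : β₁ a' ∉ branchValues β₂) :
    {b | β₂ b = β₁ a ∧ (a, b) ∈ C}.encard = {b | β₂ b = β₁ a' ∧ (a', b) ∈ C}.encard := by
  have hcrit := finite_criticalPoints hβ₂ hc₂
  refine eq_of_eventually_eq_off_finite (T := β₁ ⁻¹' branchValues β₂)
    (n := fun a => {b | β₂ b = β₁ a ∧ (a, b) ∈ C}.encard)
    (finite_preimage_of_finite hβ₁ hc₁ (hcrit.image β₂)) (fun x hx => ?_) ha ha'
  refine eventually_encard_fiber_eq hβ₁.continuous.continuousAt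
    (isCoveringMapOn_compl_branchValues hβ₂ _ hx)
    (finite_preimage_of_finite hβ₂ hc₂ (finite_singleton _)) fun b hb => ?_
  have hbc : b ∉ criticalPoints β₂ := fun h => hx ⟨b, h, hb⟩
  have h := hC (x, b) (mem_regularLocus_of_snd hb.symm hbc)
  rw [eventually_nhdsWithin_iff] at h
  have hb' : ∀ᶠ w : S₁ × S₂ in 𝓝 (x, b), w.2 ∈ (criticalPoints β₂)ᶜ :=
    continuousAt_snd.eventually_mem (hcrit.isClosed.isOpen_compl.mem_nhds hbc)
  filter_upwards [h, hb'] with w hw hwc hwe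
  exact hw (mem_regularLocus_of_snd hwe.symm hwc)

omit [T2Space S₁] [T2Space S₂] in
theorem finite_fiberProduct_over
    (hβ₁ : MDifferentiable 𝓘(ℂ, ℂ) 𝓘(ℂ, ℂ) β₁) (hβ₂ : MDifferentiable 𝓘(ℂ, ℂ) 𝓘(ℂ, ℂ) β₂)
    (hc₁ : ¬ ∃ c, ∀ z, β₁ z = c) (hc₂ : ¬ ∃ c, ∀ z, β₂ z = c) (q : S₀) :
    ((β₁ ⁻¹' {q}) ×ˢ (β₂ ⁻¹' {q})).Finite :=
  (finite_preimage_of_finite hβ₁ hc₁ (finite_singleton _)).prod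
    (finite_preimage_of_finite hβ₂ hc₂ (finite_singleton _))

theorem dvd_ncard_inter_fiber_fst
    (hβ₁ : MDifferentiable 𝓘(ℂ, ℂ) 𝓘(ℂ, ℂ) β₁) (hβ₂ : MDifferentiable 𝓘(ℂ, ℂ) 𝓘(ℂ, ℂ) β₂)
    (hc₁ : ¬ ∃ c, ∀ z, β₁ z = c) (hc₂ : ¬ ∃ c, ∀ z, β₂ z = c)
    {C : Set (S₁ × S₂)} (hC : IsClopenIn C (regularLocus β₁ β₂)) {q : S₀}
    (hq : q ∉ branchValues β₂) :
    (β₁ ⁻¹' {q}).ncard ∣ (C ∩ (β₁ ⁻¹' {q}) ×ˢ (β₂ ⁻¹' {q})).ncard := by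
  classical
  have hA := finite_preimage_of_finite hβ₁ hc₁ (finite_singleton q)
  have hG := (finite_fiberProduct_over hβ₁ hβ₂ hc₁ hc₂ q).subset (inter_subset_right (s := C))
  rcases (β₁ ⁻¹' {q}).eq_empty_or_nonempty with he | ⟨a₀, ha₀⟩
  · simp [he]
  rw [ncard_eq_toFinset_card _ hA, ncard_eq_toFinset_card _ hG,
    Finset.card_eq_sum_card_fiberwise (f := Prod.fst) (t := hA.toFinset)
      (fun w hw => by simpa using ((hG.mem_toFinset).1 hw).2.1),
    Finset.sum_const_nat (m := {b | β₂ b = β₁ a₀ ∧ (a₀, b) ∈ C}.ncard)]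
  · exact dvd_mul_right _ _
  · intro a ha
    have ha : β₁ a = q := hA.mem_toFinset.1 ha
    have ha₀ : β₁ a₀ = q := ha₀
    have hn : {b | β₂ b = β₁ a₀ ∧ (a₀, b) ∈ C}.ncard = {b | β₂ b = β₁ a ∧ (a, b) ∈ C}.ncard :=
      congrArg ENat.toNat (encard_snd_fiber_eq hβ₁ hβ₂ hc₁ hc₂ hC (ha₀ ▸ hq) (ha ▸ hq))
    rw [hn, ← ncard_image_of_injective _ (Prod.mk_right_injective a), ← ncard_coe_finset]
    refine congrArg ncard ?_
    ext ⟨x, y⟩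
    simp only [Finset.coe_filter, Finite.mem_toFinset, mem_ofPred_eq, mem_image, mem_inter_iff,
      mem_prod, mem_preimage, mem_singleton_iff, Prod.mk.injEq]
    constructor
    · rintro ⟨⟨h1, h2, h3⟩, rfl⟩
      exact ⟨y, ⟨by rw [h2, h3], h1⟩, rfl, rfl⟩
    · rintro ⟨b, ⟨h1, h2⟩, rfl, rfl⟩
      exact ⟨⟨h2, ha, h1.trans ha⟩, rfl⟩

/-- The point `w` may itself lie over a branch value. Sliding it along the local graph reaches a
point of `C` over an `a` with `β₁ a` not a branch value of `β₂`; constancy of the count then carries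
nonemptiness to a point over `q`. -/
theorem nonempty_inter_fiber_of_snd
    (hβ₁ : MDifferentiable 𝓘(ℂ, ℂ) 𝓘(ℂ, ℂ) β₁) (hβ₂ : MDifferentiable 𝓘(ℂ, ℂ) 𝓘(ℂ, ℂ) β₂)
    (hc₁ : ¬ ∃ c, ∀ z, β₁ z = c) (hc₂ : ¬ ∃ c, ∀ z, β₂ z = c)
    {C : Set (S₁ × S₂)} (hC : IsClopenIn C (regularLocus β₁ β₂)) {q : S₀}
    (hq : q ∉ branchValues β₂) (hq' : (β₁ ⁻¹' {q}).Nonempty) {w : S₁ × S₂}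
    (hw : w ∈ regularLocus β₁ β₂) (hwC : w ∈ C) (hw2 : w.2 ∉ criticalPoints β₂) :
    (C ∩ (β₁ ⁻¹' {q}) ×ˢ (β₂ ⁻¹' {q})).Nonempty := by
  have hcrit := finite_criticalPoints hβ₂ hc₂
  obtain ⟨g, N, hN, hwN, hg, hgw, hreg, -⟩ := exists_graph_regularLocus hβ₁.continuous
    (isLocalHomeomorphOn_compl_criticalPoints hβ₂) hcrit.isClosed hw hw2
  have hlim : Tendsto (fun a => (a, g a)) (𝓝 w.1) (𝓝[regularLocus β₁ β₂] w) := by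
    refine tendsto_nhdsWithin_iff.2 ⟨?_, (hN.eventually_mem hwN).mono hreg⟩
    have h : ContinuousAt (fun a => (a, g a)) w.1 :=
      continuousAt_id.prodMk (hg.continuousAt (hN.mem_nhds hwN))
    simpa [ContinuousAt, hgw] using h
  have h1 := (hlim.eventually (hC w hw)).filter_mono (nhdsWithin_le_nhds (s := {w.1}ᶜ))
  have h2 := (hlim.eventually eventually_mem_nhdsWithin).filter_mono
    (nhdsWithin_le_nhds (s := {w.1}ᶜ))
  have h3 := (finite_preimage_of_finite hβ₁ hc₁ (hcrit.image β₂)).eventually_nhdsNE_notMem w.1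
  have := neBot_nhdsNE_of_chartedSpace w.1
  obtain ⟨a, ⟨ha1, ha2⟩, ha3⟩ := ((h1.and h2).and h3).exists
  obtain ⟨a₀, ha₀ : β₁ a₀ = q⟩ := hq'
  have hne : {b | β₂ b = β₁ a₀ ∧ (a₀, b) ∈ C}.Nonempty := by
    rw [← encard_ne_zero, ← encard_snd_fiber_eq hβ₁ hβ₂ hc₁ hc₂ hC ha3 (ha₀ ▸ hq), encard_ne_zero]
    exact ⟨g a, ha2.1.symm, ha1.2 hwC⟩
  obtain ⟨b, hb, hbC⟩ := hne
  exact ⟨(a₀, b), hbC, ha₀, hb.trans ha₀⟩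

/-- A nonempty open and closed part of the regular locus has at least `lcm d₁ d₂` points over a
point that is not a branch value. -/
theorem lcm_le_ncard_inter_fiber
    (hβ₁ : MDifferentiable 𝓘(ℂ, ℂ) 𝓘(ℂ, ℂ) β₁) (hβ₂ : MDifferentiable 𝓘(ℂ, ℂ) 𝓘(ℂ, ℂ) β₂)
    (hc₁ : ¬ ∃ c, ∀ z, β₁ z = c) (hc₂ : ¬ ∃ c, ∀ z, β₂ z = c)
    {C : Set (S₁ × S₂)} (hC : IsClopenIn C (regularLocus β₁ β₂)) {q : S₀}
    (hq₁ : q ∉ branchValues β₁) (hq₂ : q ∉ branchValues β₂)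
    (hne₁ : (β₁ ⁻¹' {q}).Nonempty) (hne₂ : (β₂ ⁻¹' {q}).Nonempty) {w : S₁ × S₂}
    (hw : w ∈ regularLocus β₁ β₂) (hwC : w ∈ C) :
    Nat.lcm (β₁ ⁻¹' {q}).ncard (β₂ ⁻¹' {q}).ncard ≤
      (C ∩ (β₁ ⁻¹' {q}) ×ˢ (β₂ ⁻¹' {q})).ncard := by
  have hfin := (finite_fiberProduct_over hβ₁ hβ₂ hc₁ hc₂ q).subset (inter_subset_right (s := C))
  refine Nat.le_of_dvd ?_ (Nat.lcm_dvd (dvd_ncard_inter_fiber_fst hβ₁ hβ₂ hc₁ hc₂ hC hq₂) ?_)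
  -- The noncritical coordinate decides which projection is used to reach the fiber over `q`.
  · by_cases hw2 : w.2 ∈ criticalPoints β₂
    · have hw1 : w.1 ∉ criticalPoints β₁ := fun h => hw.2 ⟨hw.1, h, hw2⟩
      rw [← ncard_inter_fiber_swap, ncard_pos ((finite_fiberProduct_over hβ₂ hβ₁ hc₂ hc₁ q).subset
        inter_subset_right)]
      exact nonempty_inter_fiber_of_snd hβ₂ hβ₁ hc₂ hc₁ hC.swap_regularLocus hq₁ hne₂
        (swap_mem_regularLocus.2 hw) (by simpa using hwC) hw1
    · rw [ncard_pos hfin]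
      exact nonempty_inter_fiber_of_snd hβ₁ hβ₂ hc₁ hc₂ hC hq₂ hne₁ hw hwC hw2
  · rw [← ncard_inter_fiber_swap]
    exact dvd_ncard_inter_fiber_fst hβ₂ hβ₁ hc₂ hc₁ hC.swap_regularLocus hq₁

end Count

/-! ### The final count -/

/-- Pairwise disjoint sets with at least `m > 0` points each in a finite set `F` are at most
`k` in number if `F` has at most `k * m` points. -/
theorem encard_le_of_pairwise_disjoint {ι α : Type*} {I : Set ι} {F : Set α} (hF : F.Finite)
    {D : ι → Set α} {m k : ℕ} (hm : 0 < m) (hD : ∀ i ∈ I, m ≤ (D i ∩ F).ncard)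
    (hdisj : I.PairwiseDisjoint D) (hcard : F.ncard ≤ k * m) : I.encard ≤ k := by
  classical
  by_contra! h
  -- Exactly `k + 1` of the sets already give `(k + 1) * m ≤ F.ncard ≤ k * m`, which is absurd; this
  -- also covers infinite `I`.
  obtain ⟨J, hJI, hJ⟩ := exists_subset_encard_eq (Order.add_one_le_of_lt h)
  have hJfin : J.Finite := finite_of_encard_eq_coe (k := k + 1) (by exact_mod_cast hJ)
  have hJcard : hJfin.toFinset.card = k + 1 := by
    rw [hJfin.encard_eq_coe_toFinset_card] at hJ
    exact_mod_cast hJ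
  have hfin (i : ι) : (D i ∩ F).Finite := hF.subset inter_subset_right
  have h1 : (hJfin.toFinset.biUnion fun i => (hfin i).toFinset).card ≤ F.ncard := by
    rw [ncard_eq_toFinset_card F hF]
    refine Finset.card_le_card fun x hx => ?_
    simp only [Finset.mem_biUnion, Finite.mem_toFinset] at hx ⊢
    obtain ⟨_, _, h⟩ := hx
    exact h.2
  rw [Finset.card_biUnion] at h1
  · have h2 : hJfin.toFinset.card • m ≤ ∑ i ∈ hJfin.toFinset, (hfin i).toFinset.card :=
      Finset.card_nsmul_le_sum _ _ _ fun i hi => by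
        rw [← ncard_eq_toFinset_card _ (hfin i)]
        exact hD i (hJI (hJfin.mem_toFinset.1 hi))
    rw [hJcard, smul_eq_mul] at h2
    nlinarith
  · intro i hi j hj hij
    have := hdisj (hJI (hJfin.mem_toFinset.1 hi)) (hJI (hJfin.mem_toFinset.1 hj)) hij
    refine Finset.disjoint_coe.1 ?_
    simpa using this.mono inter_subset_left inter_subset_left

theorem lemma2p6
    {S₀ S₁ S₂ : Type*}
    -- three closed (that is, compact and connected) Riemann surfaces
    [TopologicalSpace S₀] [T2Space S₀] [CompactSpace S₀] [ConnectedSpace S₀]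
    [ChartedSpace ℂ S₀] [IsManifold 𝓘(ℂ, ℂ) 1 S₀]
    [TopologicalSpace S₁] [T2Space S₁] [CompactSpace S₁] [ConnectedSpace S₁]
    [ChartedSpace ℂ S₁] [IsManifold 𝓘(ℂ, ℂ) 1 S₁]
    [TopologicalSpace S₂] [T2Space S₂] [CompactSpace S₂] [ConnectedSpace S₂]
    [ChartedSpace ℂ S₂] [IsManifold 𝓘(ℂ, ℂ) 1 S₂]
    -- two non-constant holomorphic maps
    (β₁ : S₁ → S₀) (β₂ : S₂ → S₀)
    (hβ₁ : MDifferentiable 𝓘(ℂ, ℂ) 𝓘(ℂ, ℂ) β₁) (hβ₂ : MDifferentiable 𝓘(ℂ, ℂ) 𝓘(ℂ, ℂ) β₂)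
    (hc₁ : ¬ ∃ c, ∀ z, β₁ z = c) (hc₂ : ¬ ∃ c, ∀ z, β₂ z = c) :
    ∃ d₁ d₂ : ℕ, HasDegree β₁ d₁ ∧ HasDegree β₂ d₂ ∧
      (fiberProductIrreducibleComponents β₁ β₂).encard ≤ (Nat.gcd d₁ d₂ : ℕ∞) := by
  obtain ⟨d₁, hd₁, hdeg₁⟩ := exists_hasDegree hβ₁ hc₁
  obtain ⟨d₂, hd₂, hdeg₂⟩ := exists_hasDegree hβ₂ hc₂
  refine ⟨d₁, d₂, hdeg₁, hdeg₂, ?_⟩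
  have hcrit₁ := finite_criticalPoints hβ₁ hc₁
  have hcrit₂ := finite_criticalPoints hβ₂ hc₂
  obtain ⟨q, hq⟩ := ((hcrit₁.image β₁).union (hcrit₂.image β₂)).exists_notMem_of_chartedSpace
  have hq₁ : q ∉ branchValues β₁ := fun h => hq (.inl h)
  have hq₂ : q ∉ branchValues β₂ := fun h => hq (.inr h)
  have hn₁ : (β₁ ⁻¹' {q}).ncard = d₁ := by rw [ncard_def, hdeg₁.2 q hq₁, ENat.toNat_natCast]
  have hn₂ : (β₂ ⁻¹' {q}).ncard = d₂ := by rw [ncard_def, hdeg₂.2 q hq₂, ENat.toNat_natCast]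
  have hne₁ : (β₁ ⁻¹' {q}).Nonempty := nonempty_of_ncard_ne_zero (hn₁ ▸ hd₁.ne')
  have hne₂ : (β₂ ⁻¹' {q}).Nonempty := nonempty_of_ncard_ne_zero (hn₂ ▸ hd₂.ne')
  -- Closures of different components may meet at singular points, so the disjoint sets counted are
  -- the connected components themselves, each given by a base point `x R`.
  choose! x hx hR using fun R (h : R ∈ fiberProductIrreducibleComponents β₁ β₂) => h
  refine encard_le_of_pairwise_disjoint (finite_fiberProduct_over hβ₁ hβ₂ hc₁ hc₂ q)
    (D := fun R => connectedComponentIn (regularLocus β₁ β₂) (x R))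
    (m := Nat.lcm d₁ d₂) (Nat.lcm_pos hd₁ hd₂) (fun R hRm => ?_) (fun R hRm R' hRm' hne => ?_) ?_
  · rw [← hn₁, ← hn₂]
    exact lcm_le_ncard_inter_fiber hβ₁ hβ₂ hc₁ hc₂
      (isClopenIn_connectedComponentIn (exists_preconnected_nhdsWithin hβ₁.continuous
        hβ₂.continuous (isLocalHomeomorphOn_compl_criticalPoints hβ₁) hcrit₁.isClosed
        (isLocalHomeomorphOn_compl_criticalPoints hβ₂) hcrit₂.isClosed) _)
      hq₁ hq₂ hne₁ hne₂ (hx R hRm) (mem_connectedComponentIn (hx R hRm))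
  · refine (disjoint_left.2 fun w hw hw' => hne ?_)
    rw [hR R hRm, hR R' hRm', connectedComponentIn_eq hw, connectedComponentIn_eq hw']
  · rw [ncard_prod, hn₁, hn₂, Nat.gcd_mul_lcm]
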